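/- Let $(\varepsilon_n)_{n\in\mathbf Z}$ be a sequence of independent random variables with law $(\delta_{-1}+\delta_1)/2$, defined on a probability space $(\Omega,\mathcal A,P)$. Let $d\in\mathbf N$ (the case $d=0$ is allowed), let $E_d=\{-1,1\}^d$, let $\phi:E_d\to\{-1,1\}$ be any map, and put $H_n=\phi(\varepsilon_{n-d},\dots,\varepsilon_{n-1})$ for $n\in\mathbf Z$. Denote by $\mathcal F^{\varepsilon}_\infty$ and $\mathcal F^{H\varepsilon}_\infty$ the $P$-completions of the $\sigma$-fields $\sigma(\varepsilon_n,\ n\in\mathbf Z)$ and $\sigma(H_n\varepsilon_n,\ n\in\mathbf Z)$, where the $P$-completion of a $\sigma$-field $\mathcal G\subset\mathcal A$ consists of all subsets of $\Omega$ that differ from an element of $\mathcal G$ by a subset of a $P$-null event. For $\alpha\in\{-1,1\}$ define $f_\alpha:E_d\to E_d$ by $$f_\alpha(x_1,\dots,x_d)=(x_2,\dots,x_d,\alpha\,\phi(x_1,\dots,x_d)),$$ with $f_\alpha=\mathrm{id}$ if $d=0$. Elements of a subset $A\subset E_d$ are called simultaneously accordable if there is a finite sequence of signs $\alpha_1,\dots,\alpha_l\in\{-1,1\}$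 such that $f_{\alpha_l}\circ\dots\circ f_{\alpha_1}$ is constant on $A$; two elements $a,b\in E_d$ are called accordable if there is a finite sequence of signs such that $f_{\alpha_l}\circ\dots\circ f_{\alpha_1}$ takes the same value at $a$ and at $b$. Then the following three conditions are equivalent: 1. $\mathcal F^{H\varepsilon}_\infty=\mathcal F^{\varepsilon}_\infty$; 2. any two elements of $E_d$ are accordable; 3. all the elements of $E_d$ are simultaneously accordable, that is, some composition $f_{\alpha_l}\circ\dots\circ f_{\alpha_1}$ is constant on $E_d$. -/

import Mathlib

open MeasureTheory ProbabilityTheory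
open scoped ENNReal

namespace CoinToss

/-- The set `{-1, 1}` of signs, with its multiplication (and its discrete σ-field). -/
abbrev Sign : Type := ℤˣ

/-- The σ-field of the set of signs is the discrete one. -/
theorem measurableSet_sign (s : Set Sign) : MeasurableSet s :=
  ⟨Units.val '' s, trivial, Set.preimage_image_eq s Units.val_injective⟩

/-- `(ε n)`, `n ∈ ℤ`, is a coin tossing game: independent signs of law `(δ₋₁ + δ₁) / 2`. -/
structure IsCoinTossing {Ω : Type*} [MeasurableSpace Ω] (μ : Measure Ω)
    (ε : ℤ → Ω → Sign) : Prop where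
  measurable : ∀ n, Measurable (ε n)
  law : ∀ n, μ.map (ε n) = (2⁻¹ : ℝ≥0∞) • (Measure.dirac (-1) + Measure.dirac 1)
  indep : iIndepFun ε μ

/-- The σ-field generated by the whole process `X`, completed by the `μ`-null sets: an event belongs
to it iff it is `μ`-almost everywhere equal to an event of `σ(X n, n ∈ ℤ)`. -/
abbrev completedField {Ω : Type*} [MeasurableSpace Ω] (μ : Measure Ω) (X : ℤ → Ω → Sign) :
    MeasurableSpace Ω :=
  eventuallyMeasurableSpace (⨆ n, MeasurableSpace.comap (X n) inferInstance) (ae μ)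

/-- The process `H n = φ (ε (n-d), …, ε (n-1))`. -/
def predictable {Ω : Type*} {d : ℕ} (φ : (Fin d → Sign) → Sign) (ε : ℤ → Ω → Sign) :
    ℤ → Ω → Sign :=
  fun n ω => φ (fun i => ε (n - d + i) ω)

/-- The process `(H n * ε n)`, image of `ε` by the homogeneous transformation given by `φ`. -/
def transformed {Ω : Type*} {d : ℕ} (φ : (Fin d → Sign) → Sign) (ε : ℤ → Ω → Sign) :
    ℤ → Ω → Sign :=
  fun n ω => predictable φ ε n ω * ε n ω

/-- The map `f_α (x₁, …, x_d) = (x₂, …, x_d, α φ(x₁, …, x_d))`. -/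
def step {d : ℕ} (φ : (Fin d → Sign) → Sign) (α : Sign) (x : Fin d → Sign) : Fin d → Sign :=
  fun i => if h : (i : ℕ) + 1 < d then x ⟨i + 1, h⟩ else α * φ x

/-- The composition `f_{α_l} ∘ ⋯ ∘ f_{α_1}` for the finite sequence `[α_1, …, α_l]`. -/
def comp {d : ℕ} (φ : (Fin d → Sign) → Sign) (s : List Sign) (x : Fin d → Sign) : Fin d → Sign :=
  s.foldl (fun y α => step φ α y) x

/-- `a` and `b` are accordable. -/
def Accordable {d : ℕ} (φ : (Fin d → Sign) → Sign) (a b : Fin d → Sign) : Prop :=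
  ∃ s : List Sign, comp φ s a = comp φ s b

/-- The elements of `A` are simultaneously accordable. -/
def SimultaneouslyAccordable {d : ℕ} (φ : (Fin d → Sign) → Sign) (A : Set (Fin d → Sign)) : Prop :=
  ∃ s : List Sign, ∃ c : Fin d → Sign, ∀ a ∈ A, comp φ s a = c

end CoinToss

namespace CoinToss

open Filter

/-! The transformed process drives the states: the state at time `n + k` is the image of the state
at time `n` under the composition given by the word read in between (`comp_word_state`). (2 → 3) A
composition whose image has least cardinality must be constant, since otherwise a word according two
of its values would shrink the image. (3 → 1) A synchronising word almost surely occurs before any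
time, after which the state is a function of the transformed process, and so is `ε`. (1 → 2) If `a`
and `b` are not accordable, any guess of the state at time 0 from a finite window fails for some
state at the start of the window. State and window word being jointly uniform, the error is at least
`2⁻ᵈ` (`le_measure_error`), whereas equality of the fields would give arbitrarily good guesses. -/

instance : MeasurableSingletonClass Sign := ⟨fun _ => measurableSet_sign _⟩

/-- The state `(ε (n-d), …, ε (n-1))` just before time `n`. -/
def state {Ω : Type*} (d : ℕ) (ε : ℤ → Ω → Sign) (n : ℤ) (ω : Ω) : Fin d → Sign :=
  fun i => ε (n - d + i) ω

/-- The word `(X n, …, X (n+k-1))`. -/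
def word {Ω : Type*} (X : ℤ → Ω → Sign) (n : ℤ) (k : ℕ) (ω : Ω) : List Sign :=
  (List.range k).map fun i : ℕ => X (n + i) ω

/-! ### Words acting on states -/

section Combinatorics

variable {d : ℕ} {φ : (Fin d → Sign) → Sign}

theorem comp_append (s t : List Sign) (x : Fin d → Sign) :
    comp φ (s ++ t) x = comp φ t (comp φ s x) := by
  simp [comp, List.foldl_append]

/-- If the image of a composition has minimal cardinality and all pairs are accordable, then
the composition is constant. -/
theorem simultaneouslyAccordable_of_accordable (h : ∀ a b, Accordable φ a b) :
    SimultaneouslyAccordable φ Set.univ := by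
  classical
  let c : List Sign → ℕ := fun s => (Finset.univ.image (comp φ s)).card
  obtain ⟨s, hs⟩ : ∃ s, ∀ t, c s ≤ c t :=
    ⟨Function.argmin c, fun t => Function.argmin_le c t⟩
  refine ⟨s, comp φ s 1, fun a _ => ?_⟩
  by_contra hne
  obtain ⟨t, ht⟩ := h (comp φ s a) (comp φ s 1)
  have himage : Finset.univ.image (comp φ (s ++ t))
      = (Finset.univ.image (comp φ s)).image (comp φ t) := by
    rw [Finset.image_image]
    exact congrArg (fun f => Finset.univ.image f) (funext fun x => comp_append s t x)
  -- Minimality makes `comp φ t` injective on the image of `comp φ s`, although it merges two points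
  -- there.
  have hcard : ((Finset.univ.image (comp φ s)).image (comp φ t)).card
      = (Finset.univ.image (comp φ s)).card := by
    refine le_antisymm Finset.card_image_le ?_
    rw [← himage]
    exact hs (s ++ t)
  exact hne (Finset.card_image_iff.1 hcard (by simp) (by simp) ht)

end Combinatorics

/-! ### The transformed process as driver of the states -/

section Dynamics

variable {Ω : Type*} {d : ℕ} {φ : (Fin d → Sign) → Sign} {ε : ℤ → Ω → Sign}

theorem transformed_eq (n : ℤ) (ω : Ω) : transformed φ ε n ω = φ (state d ε n ω) * ε n ω := rfl

theorem eq_mul_transformed (n : ℤ) (ω : Ω) :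
    ε n ω = φ (state d ε n ω) * transformed φ ε n ω := by
  rw [transformed_eq, ← mul_assoc, Int.units_mul_self, one_mul]

theorem step_state (n : ℤ) (ω : Ω) :
    step φ (transformed φ ε n ω) (state d ε n ω) = state d ε (n + 1) ω := by
  funext i
  unfold step
  split_ifs with h
  · simp only [state]
    congr 1
    push_cast
    ring
  · rw [mul_comm, ← eq_mul_transformed]
    simp only [state]
    congr 1
    omega

theorem word_add (X : ℤ → Ω → Sign) (n : ℤ) (k l : ℕ) (ω : Ω) :
    word X n (k + l) ω = word X n k ω ++ word X (n + k) l ω := by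
  simp [word, List.range_add, add_assoc]

theorem comp_word_state (n : ℤ) (k : ℕ) (ω : Ω) :
    comp φ (word (transformed φ ε) n k ω) (state d ε n ω) = state d ε (n + k) ω := by
  induction k with
  | zero => simp [word, comp]
  | succ k ih =>
    rw [word_add, comp_append, ih]
    simpa [word, comp, add_assoc] using step_state (φ := φ) (ε := ε) (n + k) ω

/-- Prescribing the state at time `n` and the next `k` values of the transformed process amounts
to prescribing `d + k` consecutive values of `ε`. -/
theorem exists_pattern (φ : (Fin d → Sign) → Sign) (a : Fin d → Sign) (s : ℕ → Sign) (k : ℕ) :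
    ∃ w : ℕ → Sign, ∀ {Ω : Type*} (ε : ℤ → Ω → Sign) (n : ℤ) (ω : Ω),
      (state d ε n ω = a ∧ ∀ i < k, transformed φ ε (n + i) ω = s i) ↔
        ∀ j < d + k, ε (n - d + j) ω = w j := by
  induction k with
  | zero =>
    refine ⟨fun j => if h : j < d then a ⟨j, h⟩ else 1, fun ε n ω => ?_⟩
    simp only [not_lt_zero, false_imp_iff, implies_true, and_true, add_zero]
    constructor
    · rintro rfl j hj
      simp [hj, state]
    · intro h
      funext i
      simpa [state] using h i i.2
  | succ k ih =>
    obtain ⟨w, hw⟩ := ih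
    -- The state at time `n + k` is the last `d` entries of the pattern, from position `k` on, so
    -- the next sign of `ε` is forced.
    refine ⟨Function.update w (d + k) (φ (fun i => w (k + i)) * s k), fun ε n ω => ?_⟩
    have hold : (∀ j < d + (k + 1), ε (n - d + j) ω
          = Function.update w (d + k) (φ (fun i => w (k + i)) * s k) j) ↔
        (∀ j < d + k, ε (n - d + j) ω = w j) ∧
          ε (n + k) ω = φ (fun i => w (k + i)) * s k := by
      rw [← add_assoc, Nat.forall_lt_succ_right]
      refine and_congr (forall₂_congr fun j hj => ?_) ?_
      · rw [Function.update_of_ne hj.ne]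
      · rw [Function.update_self]
        have : n - d + ((d + k : ℕ) : ℤ) = n + k := by push_cast; ring
        rw [this]
    rw [hold, Nat.forall_lt_succ_right, ← and_assoc, hw ε n ω]
    refine and_congr_right fun h => ?_
    have hstate : state d ε (n + k) ω = fun i : Fin d => w (k + i) := by
      funext i
      rw [← h (k + i) (by omega)]
      simp only [state]
      congr 1
      push_cast
      ring
    rw [transformed_eq, hstate]
    constructor
    · intro h'
      rw [← h', ← mul_assoc, Int.units_mul_self, one_mul]
    · intro h'
      rw [h', ← mul_assoc, Int.units_mul_self, one_mul]

end Dynamics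

/-! ### Independence and recurrence of patterns -/

section Probability

variable {Ω : Type*} [MeasurableSpace Ω] {μ : Measure Ω} {ε : ℤ → Ω → Sign}

theorem IsCoinTossing.measure_eq (hε : IsCoinTossing μ ε) (n : ℤ) (x : Sign) :
    μ {ω | ε n ω = x} = 2⁻¹ := by
  change μ (ε n ⁻¹' {x}) = 2⁻¹
  rw [← Measure.map_apply (hε.measurable n) (measurableSet_sign _), hε.law]
  rcases Int.units_eq_one_or x with rfl | rfl
  all_goals
    have h1 : (1 : Sign) ≠ -1 := by decide
    simp [h1, h1.symm]

/-- Finitely many prescribed values at distinct times. -/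
theorem IsCoinTossing.measure_forall_eq (hε : IsCoinTossing μ ε) {ι : Type*} {g : ι → ℤ}
    (hg : g.Injective) (S : Finset ι) (w : ι → Sign) :
    μ {ω | ∀ i ∈ S, ε (g i) ω = w i} = 2⁻¹ ^ S.card := by
  have h := (hε.indep.precomp hg).measure_inter_preimage_eq_mul S (sets := fun i => {w i})
    (fun i _ => measurableSet_sign _)
  have hset : {ω | ∀ i ∈ S, ε (g i) ω = w i} = ⋂ i ∈ S, (ε (g i)) ⁻¹' {w i} := by
    ext ω
    simp
  rw [hset, h]
  exact Finset.prod_eq_pow_card fun i _ => hε.measure_eq (g i) (w i)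

theorem IsCoinTossing.measure_block (hε : IsCoinTossing μ ε) (m : ℤ) (L : ℕ) (w : ℕ → Sign) :
    μ {ω | ∀ j < L, ε (m + j) ω = w j} = 2⁻¹ ^ L := by
  have h := hε.measure_forall_eq (g := fun j : ℕ => m + j) (fun i j hij => by simpa using hij)
    (Finset.range L) w
  simpa using h

theorem measurableSet_block (hε : ∀ n, Measurable (ε n)) (m : ℤ) (L : ℕ) (w : ℕ → Sign) :
    MeasurableSet {ω | ∀ j < L, ε (m + j) ω = w j} := by
  have hset : {ω | ∀ j < L, ε (m + j) ω = w j}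
      = ⋂ j ∈ Finset.range L, (ε (m + j)) ⁻¹' {w j} := by
    ext ω
    simp
  rw [hset]
  exact Finset.measurableSet_biInter _ fun j _ => hε _ (measurableSet_sign _)

/-- Disjoint blocks of `ε` are independent, so that a given pattern almost surely occurs somewhere
before a given time. -/
theorem IsCoinTossing.ae_exists_block [IsProbabilityMeasure μ] (hε : IsCoinTossing μ ε) (m : ℤ)
    (L : ℕ) (w : ℕ → Sign) :
    ∀ᵐ ω ∂μ, ∃ k : ℕ, ∀ j < L, ε (m - (k + 1) * L + j) ω = w j := by
  let A : ℕ → Set Ω := fun k => {ω | ∀ j < L, ε (m - (k + 1) * L + j) ω = w j}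
  have hA : ∀ k, MeasurableSet (A k) := fun k => measurableSet_block hε.measurable _ L w
  have hμA : ∀ k, μ (A k) = 2⁻¹ ^ L := fun k => hε.measure_block _ L w
  -- Block number and offset are recovered by Euclidean division by `L`.
  have hg : Function.Injective fun p : ℕ × Fin L => m - (p.1 + 1) * L + (p.2 : ℤ) := by
    rintro ⟨k, i⟩ ⟨k', i'⟩ h
    have hi : (i : ℤ) < L := by exact_mod_cast i.2
    have hi' : (i' : ℤ) < L := by exact_mod_cast i'.2
    have h0 : (0 : ℤ) ≤ i := by positivity
    have h0' : (0 : ℤ) ≤ i' := by positivity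
    have h1 : (i : ℤ) + (-k) * L = i' + (-k') * L := by
      simp only at h
      linarith
    have hk : (k : ℤ) = k' := by
      have h2 := congrArg (· / (L : ℤ)) h1
      have hL : (L : ℤ) ≠ 0 := by omega
      simp only [Int.add_mul_ediv_right _ _ hL, Int.ediv_eq_zero_of_lt h0 hi,
        Int.ediv_eq_zero_of_lt h0' hi'] at h2
      omega
    rw [hk] at h1
    ext
    · exact_mod_cast hk
    · simpa using h1
  have hind : iIndepSet A μ := by
    rw [iIndepSet_iff_meas_biInter hA]
    intro S
    have h := hε.measure_forall_eq hg (S ×ˢ Finset.univ) (fun p => w p.2)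
    have hset : {ω | ∀ p ∈ S ×ˢ (Finset.univ : Finset (Fin L)),
        ε (m - (p.1 + 1) * L + (p.2 : ℤ)) ω = w p.2} = ⋂ k ∈ S, A k := by
      ext ω
      simp only [Finset.mem_product, Finset.mem_univ, and_true, Prod.forall, Set.mem_ofPred_eq,
        Set.mem_iInter, A]
      exact ⟨fun h k hk j hj => h k ⟨j, hj⟩ hk, fun h k j hk => h k hk j j.2⟩
    rw [← hset, h, Finset.prod_congr rfl fun k _ => hμA k, Finset.prod_const, Finset.card_product,
      Finset.card_univ, Fintype.card_fin, mul_comm, pow_mul]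
  -- Second Borel–Cantelli lemma: the blocks all have the same positive probability.
  have hlim := measure_limsup_eq_one hA hind (by
    simp only [hμA]
    exact ENNReal.tsum_const_eq_top_of_ne_zero (by simp))
  have hmeas : MeasurableSet (limsup A atTop) := MeasurableSet.measurableSet_limsup hA
  have hae : ∀ᵐ ω ∂μ, ω ∈ limsup A atTop := (mem_ae_iff_prob_eq_one hmeas).2 hlim
  filter_upwards [hae] with ω hω
  rw [mem_limsup_iff_frequently_mem] at hω
  exact hω.exists

theorem IsCoinTossing.measure_state_word {d : ℕ} (hε : IsCoinTossing μ ε)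
    (φ : (Fin d → Sign) → Sign) (n : ℤ) (a : Fin d → Sign) (k : ℕ) (s : ℕ → Sign) :
    μ {ω | state d ε n ω = a ∧ ∀ i < k, transformed φ ε (n + i) ω = s i} = 2⁻¹ ^ (d + k) := by
  obtain ⟨w, hw⟩ := exists_pattern φ a s k
  exact (congrArg μ (Set.ext fun ω => hw ε n ω)).trans (hε.measure_block _ _ w)

theorem measurableSet_state_word {d : ℕ} (hε : ∀ n, Measurable (ε n))
    (φ : (Fin d → Sign) → Sign) (n : ℤ) (a : Fin d → Sign) (k : ℕ) (s : ℕ → Sign) :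
    MeasurableSet {ω | state d ε n ω = a ∧ ∀ i < k, transformed φ ε (n + i) ω = s i} := by
  obtain ⟨w, hw⟩ := exists_pattern φ a s k
  rw [show {ω | state d ε n ω = a ∧ ∀ i < k, transformed φ ε (n + i) ω = s i}
    = {ω | ∀ j < d + k, ε (n - d + j) ω = w j} from Set.ext fun ω => hw ε n ω]
  exact measurableSet_block hε _ _ w

end Probability

/-! ### Generated and completed σ-fields -/

section Fields

variable {Ω : Type*}

theorem measurable_state {_ : MeasurableSpace Ω} {ε : ℤ → Ω → Sign} (d : ℕ)
    (hε : ∀ n, Measurable (ε n)) (n : ℤ) : Measurable (state d ε n) :=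
  measurable_pi_lambda _ fun _ => hε _

theorem measurable_transformed {_ : MeasurableSpace Ω} {ε : ℤ → Ω → Sign} {d : ℕ}
    (φ : (Fin d → Sign) → Sign) (hε : ∀ n, Measurable (ε n)) (n : ℤ) :
    Measurable (transformed φ ε n) :=
  (measurable_of_countable fun p : (Fin d → Sign) × Sign => φ p.1 * p.2).comp
    ((measurable_state d hε n).prodMk (hε n))

/-- The σ-field generated by a process. -/
abbrev generatedField (X : ℤ → Ω → Sign) : MeasurableSpace Ω :=
  ⨆ n, MeasurableSpace.comap (X n) inferInstance

theorem measurable_generatedField (X : ℤ → Ω → Sign) (n : ℤ) :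
    Measurable[generatedField X] (X n) :=
  measurable_iff_comap_le.2 (le_iSup (fun n => MeasurableSpace.comap (X n) inferInstance) n)

theorem generatedField_le {m : MeasurableSpace Ω} {X : ℤ → Ω → Sign} (hX : ∀ n, Measurable (X n)) :
    generatedField X ≤ m :=
  iSup_le fun n => (hX n).comap_le

theorem measurableSet_setOf_word {_ : MeasurableSpace Ω} {X : ℤ → Ω → Sign}
    (hX : ∀ n, Measurable (X n)) (n : ℤ) (k : ℕ) (p : List Sign → Prop) :
    MeasurableSet {ω | p (word X n k ω)} := by
  have hf : Measurable fun ω (i : Fin k) => X (n + (i : ℕ)) ω :=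
    measurable_pi_lambda _ fun _ => hX _
  have hset : {ω | p (word X n k ω)}
      = (fun ω (i : Fin k) => X (n + (i : ℕ)) ω) ⁻¹' {x | p (List.ofFn x)} := by
    ext ω
    have : word X n k ω = List.ofFn fun i : Fin k => X (n + (i : ℕ)) ω := by
      simp [word, List.ofFn_eq_map, ← List.map_coe_finRange_eq_range, Function.comp_def]
    simp [this]
  rw [hset]
  exact hf (Set.toFinite _).measurableSet

/-- The event `D` depends only on the values of `X` at the times in `[-N, N]`. -/
def WindowEvent (X : ℤ → Ω → Sign) (N : ℕ) (D : Set Ω) : Prop :=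
  ∀ ω ω', (∀ i ∈ Finset.Icc (-(N : ℤ)) N, X i ω = X i ω') → ω ∈ D → ω' ∈ D

theorem WindowEvent.mono {X : ℤ → Ω → Sign} {N M : ℕ} {D : Set Ω} (h : WindowEvent X N D)
    (hNM : N ≤ M) : WindowEvent X M D := fun ω ω' hω => h ω ω' fun i hi => hω i <| by
  rw [Finset.mem_Icc] at hi ⊢
  omega

theorem WindowEvent.measurableSet {X : ℤ → Ω → Sign} {N : ℕ} {D : Set Ω} (h : WindowEvent X N D) :
    MeasurableSet[generatedField X] D := by
  let _ := generatedField X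
  let f : Ω → (Finset.Icc (-(N : ℤ)) N → Sign) := fun ω i => X i ω
  have hf : Measurable f :=
    measurable_pi_lambda _ fun i => measurable_generatedField X i
  have hset : D = f ⁻¹' (f '' D) := by
    refine (Set.subset_preimage_image f D).antisymm ?_
    rintro ω ⟨ω', hω', hf⟩
    exact h ω' ω (fun i hi => congrFun hf ⟨i, hi⟩) hω'
  rw [hset]
  exact hf (Set.toFinite _).measurableSet

theorem isSetAlgebra_windowEvent (X : ℤ → Ω → Sign) :
    IsSetAlgebra {D | ∃ N, WindowEvent X N D} where
  empty_mem := ⟨0, fun _ _ _ h => h⟩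
  compl_mem := fun _ ⟨N, hN⟩ =>
    ⟨N, fun ω ω' h hω hω' => hω (hN ω' ω (fun i hi => (h i hi).symm) hω')⟩
  union_mem := fun _ _ ⟨N, hN⟩ ⟨M, hM⟩ => ⟨max N M, fun ω ω' h hω =>
    hω.imp (hN.mono (le_max_left N M) ω ω' h) (hM.mono (le_max_right N M) ω ω' h)⟩

theorem generatedField_eq_generateFrom (X : ℤ → Ω → Sign) :
    generatedField X = MeasurableSpace.generateFrom {D | ∃ N, WindowEvent X N D} := by
  refine le_antisymm (iSup_le fun n => ?_) (MeasurableSpace.generateFrom_le ?_)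
  · rintro _ ⟨B, -, rfl⟩
    refine MeasurableSpace.measurableSet_generateFrom ⟨n.natAbs, fun ω ω' h hω => ?_⟩
    have := h n (by rw [Finset.mem_Icc]; omega)
    rwa [Set.mem_preimage, ← this]
  · rintro D ⟨N, hN⟩
    exact hN.measurableSet

variable [MeasurableSpace Ω] {μ : Measure Ω}

theorem completedField_le {X Y : ℤ → Ω → Sign} (h : ∀ n, Measurable[completedField μ Y] (X n)) :
    completedField μ X ≤ completedField μ Y := by
  rintro s ⟨t, ht, hst⟩
  exact EventuallyMeasurableSet.congr (generatedField_le h t ht) hst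

theorem measurable_completedField (X : ℤ → Ω → Sign) (n : ℤ) :
    Measurable[completedField μ X] (X n) :=
  (measurable_generatedField X n).mono le_eventuallyMeasurableSpace le_rfl

theorem completedField_transformed_le {d : ℕ} (φ : (Fin d → Sign) → Sign) (ε : ℤ → Ω → Sign) :
    completedField μ (transformed φ ε) ≤ completedField μ ε :=
  completedField_le (measurable_transformed φ (measurable_completedField ε))

/-- If some word synchronises all the states, almost surely it has occurred in the past of any given
time, so that the transformed process determines the states. -/
theorem measurable_state_of_simultaneouslyAccordable [IsProbabilityMeasure μ] {ε : ℤ → Ω → Sign}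
    (hε : IsCoinTossing μ ε) {d : ℕ} {φ : (Fin d → Sign) → Sign}
    (h : SimultaneouslyAccordable φ Set.univ) (n : ℤ) :
    Measurable[completedField μ (transformed φ ε)] (state d ε n) := by
  obtain ⟨s, c, hs⟩ := h
  refine @measurable_to_countable' _ _ _ _ (completedField μ (transformed φ ε)) _ fun x => ?_
  refine ⟨⋃ k : ℕ, {ω | ∀ a, comp φ (word (transformed φ ε) (n - k) k ω) a = x},
    MeasurableSet.iUnion fun k => measurableSet_setOf_word (measurable_generatedField _) _ _
      fun t => ∀ a, comp φ t a = x, ?_⟩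
  -- The initial state `1` is arbitrary: it only turns the word `s` into a block of `ε`.
  obtain ⟨w, hw⟩ := exists_pattern φ 1 (fun i => s.getD i 1) s.length
  filter_upwards [hε.ae_exists_block n (d + s.length) w] with ω ⟨k, hk⟩
  have hstate (k : ℕ) : comp φ (word (transformed φ ε) (n - k) k ω) (state d ε (n - k) ω)
      = state d ε n ω := by
    rw [comp_word_state, sub_add_cancel]
  refine propext ?_
  change state d ε n ω = x ↔ ω ∈ ⋃ k : ℕ, _
  rw [Set.mem_iUnion]
  refine ⟨fun hx => ?_, fun ⟨k, hk⟩ => ?_⟩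
  swap
  · exact (hstate k).symm.trans (hk _)
  -- The number of letters read between the end of the occurrence of `s` and time `n`.
  let r := k * (d + s.length)
  have hsplit : n - ((s.length + r : ℕ) : ℤ) - d = n - (k + 1) * (d + s.length : ℕ) := by
    simp only [r]
    push_cast
    ring
  have hblock := (hw ε (n - (s.length + r : ℕ)) ω).2 (by rwa [hsplit])
  have hword : word (transformed φ ε) (n - (s.length + r : ℕ)) s.length ω = s := by
    refine List.ext_getElem (by simp [word]) fun i hi hi' => ?_
    have := hblock.2 i hi'
    simpa [word, hi'] using this
  refine ⟨s.length + r, fun a => ?_⟩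
  rw [← hx, ← hstate (s.length + r), word_add, hword]
  simp only [comp_append, hs _ (Set.mem_univ _)]

theorem completedField_eq_of_simultaneouslyAccordable [IsProbabilityMeasure μ]
    {ε : ℤ → Ω → Sign} (hε : IsCoinTossing μ ε) {d : ℕ} {φ : (Fin d → Sign) → Sign}
    (h : SimultaneouslyAccordable φ Set.univ) :
    completedField μ (transformed φ ε) = completedField μ ε := by
  refine le_antisymm (completedField_transformed_le φ ε) (completedField_le fun n => ?_)
  rw [show ε n = fun ω => φ (state d ε n ω) * transformed φ ε n ω from
    funext fun ω => eq_mul_transformed n ω]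
  exact (measurable_of_countable fun p : (Fin d → Sign) × Sign => φ p.1 * p.2).comp
    ((measurable_state_of_simultaneouslyAccordable hε h n).prodMk (measurable_completedField _ n))

/-- Window events form an algebra generating the σ-field, hence are dense in it for the measure. -/
theorem exists_windowEvent_measure_symmDiff_lt [IsFiniteMeasure μ] {X : ℤ → Ω → Sign}
    (hX : ∀ n, Measurable (X n)) {C : Set Ω} (hC : MeasurableSet[generatedField X] C) {δ : ℝ}
    (hδ : 0 < δ) :
    ∃ N D, WindowEvent X N D ∧ μ (symmDiff C D) < ENNReal.ofReal δ := by
  have hle := generatedField_le hX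
  have hdense := @Measure.MeasureDense.of_generateFrom_isSetAlgebra_finite _ (generatedField X)
    (μ.trim hle) _ _ (isSetAlgebra_windowEvent X) (generatedField_eq_generateFrom X)
  obtain ⟨D, ⟨N, hN⟩, hD⟩ :=
    @Measure.MeasureDense.approx _ (generatedField X) _ _ hdense C hC (measure_ne_top _ _) δ hδ
  refine ⟨N, D, hN, ?_⟩
  rwa [trim_measurableSet_eq hle (hC.symmDiff hN.measurableSet)] at hD

theorem two_pow_mul_inv_two_pow_add (d k : ℕ) :
    (2 : ℝ≥0∞) ^ k * 2⁻¹ ^ (d + k) = 2⁻¹ ^ d := by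
  rw [pow_add, mul_left_comm, ← mul_pow, ENNReal.mul_inv_cancel two_ne_zero ENNReal.ofNat_ne_top,
    one_pow, mul_one]

/-- If two states are not accordable, no events in a finite window of the transformed process tell
the current state with a probability of error less than `2⁻ᵈ`. -/
theorem IsCoinTossing.le_measure_error {ε : ℤ → Ω → Sign} (hε : IsCoinTossing μ ε) {d : ℕ}
    {φ : (Fin d → Sign) → Sign} {a b : Fin d → Sign} (hab : ¬ Accordable φ a b) {N : ℕ}
    {D : (Fin d → Sign) → Set Ω} (hD : ∀ x, WindowEvent (transformed φ ε) N (D x)) :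
    2⁻¹ ^ d ≤ μ {ω | ¬ ∀ x, state d ε 0 ω = x ↔ ω ∈ D x} := by
  classical
  -- The number of times in `[-N, N]`; only the first `N` letters act on the state between times
  -- `-N` and 0.
  let k := 2 * N + 1
  let ext : (Fin k → Sign) → ℕ → Sign := fun s i => if h : i < k then s ⟨i, h⟩ else 1
  let agree : (Fin k → Sign) → Ω → Prop := fun s ω =>
    ∀ i < k, transformed φ ε (-(N : ℤ) + (i : ℕ)) ω = ext s i
  let good : (Fin k → Sign) → (Fin d → Sign) → Prop := fun s c =>
    ∀ x, comp φ ((List.range N).map (ext s)) c = x ↔ ∃ ω, agree s ω ∧ ω ∈ D x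
  have hbad : ∀ s, ∃ c, ¬ good s c := by
    -- Were `a` and `b` both good, the same verdict would force their images under the word to
    -- coincide.
    intro s
    by_contra! h
    exact hab ⟨_, (h a _).2 ((h b _).1 rfl)⟩
  choose c hc using hbad
  let B : (Fin k → Sign) → Set Ω := fun s => {ω | state d ε (-(N : ℤ)) ω = c s ∧ agree s ω}
  have hB : ∀ s, B s ⊆ {ω | ¬ ∀ x, state d ε 0 ω = x ↔ ω ∈ D x} := by
    rintro s ω ⟨hω, hs⟩ h
    refine hc s fun x => ?_
    have hword : word (transformed φ ε) (-(N : ℤ)) N ω = (List.range N).map (ext s) := by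
      refine List.map_congr_left fun i hi => hs i ?_
      rw [List.mem_range] at hi
      omega
    have hstate := comp_word_state (φ := φ) (ε := ε) (-(N : ℤ)) N ω
    rw [hword, hω, neg_add_cancel] at hstate
    rw [hstate, h x]
    refine ⟨fun hx => ⟨ω, hs, hx⟩, fun ⟨ω', hs', hx⟩ => hD x ω' ω (fun i hi => ?_) hx⟩
    rw [Finset.mem_Icc] at hi
    obtain ⟨j, hj⟩ := Int.eq_ofNat_of_zero_le (a := i + N) (by omega)
    obtain rfl : i = -(N : ℤ) + (j : ℕ) := by omega
    rw [hs j (by omega), hs' j (by omega)]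
  have hdisj : Pairwise (Function.onFun Disjoint B) := by
    intro s t hst
    refine Set.disjoint_left.2 fun ω hs ht => hst (funext fun i => ?_)
    have := (hs.2 i i.2).symm.trans (ht.2 i i.2)
    simpa [ext] using this
  have hmeas : ∀ s, MeasurableSet (B s) := fun s =>
    measurableSet_state_word hε.measurable φ _ (c s) k (ext s)
  calc (2⁻¹ : ℝ≥0∞) ^ d = ∑ _s : Fin k → Sign, (2⁻¹ : ℝ≥0∞) ^ (d + k) := by
        rw [Finset.sum_const, Finset.card_univ, Fintype.card_fun, Fintype.card_fin,
          Fintype.card_units_int, nsmul_eq_mul, Nat.cast_pow, Nat.cast_ofNat,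
          two_pow_mul_inv_two_pow_add]
    _ = ∑ s, μ (B s) := Finset.sum_congr rfl fun s _ =>
        (hε.measure_state_word φ _ (c s) k (ext s)).symm
    _ = μ (⋃ s, B s) := by rw [measure_iUnion hdisj hmeas, tsum_fintype]
    _ ≤ _ := measure_mono (Set.iUnion_subset hB)

theorem accordable_of_completedField_eq [IsProbabilityMeasure μ] {ε : ℤ → Ω → Sign}
    (hε : IsCoinTossing μ ε) {d : ℕ} {φ : (Fin d → Sign) → Sign}
    (h : completedField μ (transformed φ ε) = completedField μ ε) (a b : Fin d → Sign) :
    Accordable φ a b := by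
  by_contra hab
  have hC : ∀ x, ∃ C, MeasurableSet[generatedField (transformed φ ε)] C ∧
      {ω | state d ε 0 ω = x} =ᵐ[μ] C := by
    intro x
    change MeasurableSet[completedField μ (transformed φ ε)] {ω | state d ε 0 ω = x}
    rw [h]
    exact measurable_state d (measurable_completedField ε) 0 (measurableSet_singleton x)
  choose C hCm hC using hC
  choose N D hN hD using fun x => exists_windowEvent_measure_symmDiff_lt (μ := μ)
    (measurable_transformed φ hε.measurable) (hCm x)
    -- Summed over the `2 ^ d` states, these errors stay below `2⁻ᵈ`.
    (δ := 2⁻¹ ^ (d + d)) (by positivity)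
  have herr := hε.le_measure_error hab fun x =>
    (hN x).mono (Finset.le_sup (f := N) (Finset.mem_univ x))
  refine herr.not_gt ?_
  have hsub : {ω | ¬ ∀ x, state d ε 0 ω = x ↔ ω ∈ D x}
      ⊆ ⋃ x, symmDiff {ω | state d ε 0 ω = x} (D x) := by
    intro ω hω
    obtain ⟨x, hx⟩ := not_forall.1 hω
    refine Set.mem_iUnion.2 ⟨x, ?_⟩
    rw [Set.mem_symmDiff, Set.mem_ofPred_eq]
    tauto
  calc μ {ω | ¬ ∀ x, state d ε 0 ω = x ↔ ω ∈ D x}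
      ≤ ∑ x, μ (symmDiff {ω | state d ε 0 ω = x} (D x)) :=
        (measure_mono hsub).trans (measure_iUnion_fintype_le _ _)
    _ = ∑ x, μ (symmDiff (C x) (D x)) := Finset.sum_congr rfl fun x _ =>
        measure_congr ((hC x).symmDiff (ae_eq_refl _))
    _ < ∑ _x : Fin d → Sign, ENNReal.ofReal (2⁻¹ ^ (d + d)) :=
        ENNReal.sum_lt_sum_of_nonempty Finset.univ_nonempty fun x _ => hD x
    _ = 2⁻¹ ^ d := by
        rw [ENNReal.ofReal_pow (by positivity), ENNReal.ofReal_inv_of_pos two_pos,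
          ENNReal.ofReal_ofNat, Finset.sum_const, Finset.card_univ, Fintype.card_fun,
          Fintype.card_fin, Fintype.card_units_int, nsmul_eq_mul, Nat.cast_pow, Nat.cast_ofNat,
          two_pow_mul_inv_two_pow_add]

end Fields

end CoinToss

theorem mainTheorem2 {Ω : Type*} [MeasurableSpace Ω] (μ : Measure Ω) [IsProbabilityMeasure μ]
    (ε : ℤ → Ω → CoinToss.Sign) (hε : CoinToss.IsCoinTossing μ ε)
    (d : ℕ) (φ : (Fin d → CoinToss.Sign) → CoinToss.Sign) :
    List.TFAE
      [CoinToss.completedField μ (CoinToss.transformed φ ε) = CoinToss.completedField μ ε,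
       ∀ a b : Fin d → CoinToss.Sign, CoinToss.Accordable φ a b,
       CoinToss.SimultaneouslyAccordable φ Set.univ] := by
  tfae_have 1 → 2 := CoinToss.accordable_of_completedField_eq hε
  tfae_have 2 → 3 := CoinToss.simultaneouslyAccordable_of_accordable
  tfae_have 3 → 1 := CoinToss.completedField_eq_of_simultaneouslyAccordable hε
  tfae_finish
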